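/- Let $\lambda<0$ and let $f$ be analytic in the half-plane $\operatorname{Re} z>\lambda$. Assume that $f$ has moderate growth in the following sense: there are real constants $\beta<\tfrac12$ and $C$ such that $$|f(re^{i\theta})|\le C\,e^{r\psi(\theta)}(1+r)^{\beta}\qquad (r\ge 0,\ |\theta|\le \tfrac{\pi}{2}),\qquad \psi(\theta)=\cos\theta\,\ln(2\cos\theta)+\theta\sin\theta,$$ where $\cos\theta\ln(2\cos\theta)$ is read as $0$ at $\theta=\pm\tfrac{\pi}{2}$. (Since $\psi\ge\ln 2$, this holds in particular if $f$ has polynomial growth, or if $|f(z)|\le C e^{c|z|}$ with some $c<\ln 2$, for $\operatorname{Re} z\ge 0$.) Then $$\int_0^1 f(x)\,dx=\sum_{n=0}^\infty \frac{(-1)^n c_n}{n!}\left\{\sum_{k=0}^n\binom nk(-1)^k f(k)\right\},$$ where the series converges (its partial sums tend to the left-hand side), and $c_n=\int_0^1 z(z-1)\cdots(z-n+1)\,dz$ ($c_0=1$) are the Cauchy numbers. -/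

import Mathlib

open Filter Topology

/-- The Cauchy number (of the first kind) `c_n = ∫_0^1 z (z - 1) ⋯ (z - n + 1) dz`. -/
noncomputable def cauchyNumber (n : ℕ) : ℝ :=
  ∫ z in (0 : ℝ)..1, ∏ j ∈ Finset.range n, (z - (j : ℝ))

/-- The extremal indicator function of the theory of Newton interpolation series with nodes
`0, 1, 2, …`, considered for `|θ| ≤ π / 2`. Its value at `θ = ± π / 2` is `π / 2`
(where `cos θ * log (2 cos θ)` is read as `0`), and its minimum is its value `log 2` at `0`. -/
noncomputable def newtonIndicator (θ : ℝ) : ℝ :=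
  Real.cos θ * Real.log (2 * Real.cos θ) + θ * Real.sin θ

/-- Moderate growth, in the sense of the classical theory of Newton interpolation series:
`f (r e^{iθ}) = O (e^{r ψ(θ)} (1 + r) ^ β)` in the closed right half-plane, for some `β < 1 / 2`,
where `ψ` is `newtonIndicator`. Since `ψ ≥ log 2`, this includes all functions of polynomial
growth and all functions of exponential type less than `log 2`. -/
def HasModerateGrowth (f : ℂ → ℂ) : Prop :=
  ∃ β : ℝ, β < 1 / 2 ∧ ∃ C : ℝ, ∀ z : ℂ, 0 ≤ z.re →
    ‖f z‖ ≤ C * Real.exp (‖z‖ * newtonIndicator z.arg) * (1 + ‖z‖) ^ β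

/-! Write `f z = f 0 + z * g z` with `g = dslope f 0`. Interpolating `g` at `1, …, N` gives Newton's
formula for `f` at `0, …, N`, with remainder `x * nodeProd N x * dividedDiff g N N N x`, a Cauchy
integral (`sub_newton_sum_eq`). Dividing out the node `0` lets the contour be the circle `|s - N| =
N` through `0`, which stays in the closed right half-plane, where the growth bound holds.

On this circle `N! e^{rψ(θ)} ≤ K r^{1/2} |(s - 1) ⋯ (s - N)|` for `s = re^{iθ}`, `r ≥ 1`
(`exists_factorial_mul_exp_le`): comparing `∑ log |s - j|` with the integral of the logarithm by the
trapezoidal rule produces `ψ` exactly. The growth of `f` is thus absorbed. Together with `g ~ f / s`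
and the Cauchy kernel, the integrand is `O((1 + r)^{-(3/2 - β)})` times `1 / N!`; as `β < 1/2`, its
integral over the circle, without that factor, is bounded independently of `N`.

Since `|(x - 1) ⋯ (x - N)| ≤ N! e^{-x H_N}` with `H_N` the harmonic sum, the remainder is at most `K
e^{-x H_N}` on `(0, 1]` (`exists_norm_remainder_le`). It is bounded by `K` and tends to `0`
pointwise, so dominated convergence permits integration of the Newton series over `[0, 1]`. -/

/-! ### Geometry of a circle through the origin, tangent to the imaginary axis. -/

theorem norm_sq_of_norm_sub_eq {R : ℝ} {s : ℂ} (hs : ‖s - R‖ = R) :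
    ‖s‖ ^ 2 = 2 * R * s.re := by
  have h : ‖s - R‖ ^ 2 = R ^ 2 := by rw [hs]
  rw [Complex.sq_norm, Complex.normSq_apply] at h ⊢
  simp at h
  linarith

/-- Rests on `R |s - t|² = |s|² (R - t) + R t²`. If `2t ≤ R`, the first term controls `|s|²`;
otherwise `|s| ≤ 2R ≤ 4t`, whence 17 = 16 + 1. -/
theorem norm_sq_add_sq_le {R t : ℝ} {s : ℂ} (hR : 0 < R) (hs : ‖s - R‖ = R)
    (ht : 0 ≤ t) (htR : t ≤ R) : ‖s‖ ^ 2 + t ^ 2 ≤ 17 * ‖s - t‖ ^ 2 := by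
  have h1 := norm_sq_of_norm_sub_eq hs
  have h2 : ‖s - t‖ ^ 2 = ‖s‖ ^ 2 - 2 * t * s.re + t ^ 2 := by
    simp only [Complex.sq_norm, Complex.normSq_apply]
    simp
    ring
  have h3 : s.re ≤ ‖s‖ := Complex.re_le_norm s
  have h4 : R * ‖s - t‖ ^ 2 = ‖s‖ ^ 2 * (R - t) + R * t ^ 2 := by
    rw [h2]; linear_combination t * h1
  have h5 : ‖s‖ ≤ 2 * R := by
    by_contra! h
    nlinarith [mul_pos (by linarith : 0 < ‖s‖) (sub_pos.2 h)]
  refine le_of_mul_le_mul_left ?_ hR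
  rw [mul_left_comm, h4]
  rcases le_total (2 * t) R with h | h
  · nlinarith [mul_nonneg (sq_nonneg ‖s‖) (sub_nonneg.2 h), mul_nonneg hR.le (sq_nonneg t),
      mul_nonneg hR.le (sq_nonneg ‖s‖)]
  · have h6 : ‖s‖ ^ 2 ≤ 16 * t ^ 2 := by nlinarith [norm_nonneg s]
    nlinarith [mul_nonneg (sq_nonneg ‖s‖) (sub_nonneg.2 htR), mul_le_mul_of_nonneg_left h6 hR.le]

theorem re_pos_of_norm_sub_eq {R : ℝ} {s : ℂ} (hR : 0 < R) (hs : ‖s - R‖ = R) (h0 : s ≠ 0) :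
    0 < s.re := by
  have h1 := norm_sq_of_norm_sub_eq hs
  have h2 : 0 < ‖s‖ ^ 2 := by positivity
  rw [h1] at h2
  exact pos_of_mul_pos_right h2 (by positivity)

/-- The circle meets the real axis only at `0` and `2R`, so the principal logarithm is smooth along
the segment from `s` to `s - R`. -/
theorem sub_mem_slitPlane {R t : ℝ} {s : ℂ} (hR : 0 < R) (hs : ‖s - R‖ = R) (h0 : s ≠ 0)
    (htR : t ≤ R) : s - t ∈ Complex.slitPlane := by
  have h1 := norm_sq_of_norm_sub_eq hs
  have h2 := re_pos_of_norm_sub_eq hR hs h0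
  rw [Complex.sq_norm, Complex.normSq_apply] at h1
  rw [Complex.mem_slitPlane_iff]
  by_cases hb : s.im = 0
  · left
    rw [hb] at h1
    have : s.re = 2 * R := by
      apply mul_right_cancel₀ h2.ne'
      linarith
    simp [this]
    linarith
  · right
    simpa using hb

/-! ### Trapezoidal rule for the logarithm and the origin of the indicator. -/

/-- A primitive of the complex logarithm. -/
noncomputable def logPrimitive (w : ℂ) : ℂ := w * Complex.log w - w

theorem hasDerivAt_logPrimitive {w : ℂ} (hw : w ∈ Complex.slitPlane) :
    HasDerivAt logPrimitive (Complex.log w) w := by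
  have h0 : w ≠ 0 := Complex.slitPlane_ne_zero hw
  have := ((hasDerivAt_id w).mul (Complex.hasDerivAt_log hw)).sub (hasDerivAt_id w)
  refine this.congr_deriv ?_
  simp [h0]

/-- The error of the trapezoidal rule for the logarithm on a unit interval. -/
theorem norm_logPrimitive_sub_trapezoid_le {w : ℂ} {M : ℝ} (hM : 0 ≤ M)
    (hw : ∀ t : ℝ, 0 ≤ t → t ≤ 1 → w - t ∈ Complex.slitPlane)
    (hb : ∀ t : ℝ, 0 ≤ t → t ≤ 1 → 1 ≤ M * ‖w - t‖ ^ 2) :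
    ‖logPrimitive w - logPrimitive (w - 1) - (Complex.log w + Complex.log (w - 1)) / 2‖ ≤ M := by
  have hsub : ∀ t : ℝ, HasDerivAt (fun t : ℝ => w - (t : ℂ)) (-1) t := fun t => by
    simpa using (Complex.ofRealCLM.hasDerivAt (x := t)).const_sub w
  have hlog : ∀ t : ℝ, 0 ≤ t → t ≤ 1 →
      HasDerivAt (fun t : ℝ => Complex.log (w - (t : ℂ))) (-1 / (w - t)) t := fun t h0 h1 =>
    (hsub t).clog_real (hw t h0 h1)
  have hid : ∀ t : ℝ, HasDerivAt (fun t : ℝ => (t : ℂ) / 2) (1 / 2) t := fun t => by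
    simpa using (Complex.ofRealCLM.hasDerivAt (x := t)).div_const 2
  -- `E` below has increment over `[0, 1]` equal to the trapezoid error, and `D` is its derivative.
  -- As `D 0 = 0`, a bound on `D'` passes to `D` and then to `E`.
  let D : ℝ → ℂ := fun t =>
    (Complex.log (w - t) - Complex.log w) / 2 + (t : ℂ) / 2 * (1 / (w - t))
  have hD : ∀ t : ℝ, 0 ≤ t → t ≤ 1 → HasDerivAt D ((t : ℂ) / 2 * (1 / (w - t) ^ 2)) t := by
    intro t h0 h1
    have hne : w - (t : ℂ) ≠ 0 := Complex.slitPlane_ne_zero (hw t h0 h1)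
    have h := (((hlog t h0 h1).sub_const (Complex.log w)).div_const 2).add
      ((hid t).mul ((hasDerivAt_const t (1 : ℂ)).div (hsub t) hne))
    refine h.congr_deriv ?_
    simp only [Pi.div_apply]
    field_simp
    ring
  have hDb : ∀ t ∈ Set.Icc (0 : ℝ) 1, ‖D t‖ ≤ M := by
    intro t ht
    have := Convex.norm_image_sub_le_of_norm_hasDerivWithin_le (C := M) (s := Set.Icc (0 : ℝ) 1)
      (fun x hx => (hD x hx.1 hx.2).hasDerivWithinAt) (fun x hx => ?_) (convex_Icc 0 1)
      (Set.left_mem_Icc.2 zero_le_one) ht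
    · have h0 : D 0 = 0 := by simp [D]
      rw [h0, sub_zero, sub_zero, Real.norm_eq_abs, abs_of_nonneg ht.1] at this
      exact this.trans (mul_le_of_le_one_right hM ht.2)
    · have hne : w - (x : ℂ) ≠ 0 := Complex.slitPlane_ne_zero (hw x hx.1 hx.2)
      have hpos : 0 < ‖w - (x : ℂ)‖ ^ 2 := by positivity
      have hle : 1 / ‖w - (x : ℂ)‖ ^ 2 ≤ M := (div_le_iff₀ hpos).2 (hb x hx.1 hx.2)
      rw [norm_mul, norm_div, norm_div, norm_pow, Complex.norm_real, Real.norm_eq_abs,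
        abs_of_nonneg hx.1]
      simp only [norm_one, Complex.norm_ofNat]
      calc x / 2 * (1 / ‖w - (x : ℂ)‖ ^ 2) ≤ 1 * M := by
            gcongr
            linarith [hx.2]
        _ = M := one_mul M
  let E : ℝ → ℂ := fun t => -logPrimitive (w - t) - (t : ℂ) / 2 *
    (Complex.log w + Complex.log (w - t))
  have hE : ∀ t : ℝ, 0 ≤ t → t ≤ 1 → HasDerivAt E (D t) t := by
    intro t h0 h1
    have hne : w - (t : ℂ) ≠ 0 := Complex.slitPlane_ne_zero (hw t h0 h1)
    have h := ((hasDerivAt_logPrimitive (hw t h0 h1)).comp t (hsub t)).neg.sub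
      ((hid t).mul ((hlog t h0 h1).const_add (Complex.log w)))
    refine h.congr_deriv ?_
    simp only [D]
    ring
  have := norm_image_sub_le_of_norm_deriv_le_segment_01' (f := E) (C := M)
    (fun x hx => (hE x hx.1 hx.2).hasDerivWithinAt)
    (fun x hx => hDb x (Set.Ico_subset_Icc_self hx))
  have hval : E 1 - E 0 = logPrimitive w - logPrimitive (w - 1) -
      (Complex.log w + Complex.log (w - 1)) / 2 := by
    simp only [E, Complex.ofReal_one, Complex.ofReal_zero, sub_zero]
    ring
  rwa [hval] at this

/-- With `s = re^{iθ}` on the circle, `r = 2R cos θ` and, by the inscribed angle theorem, `s - R = R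
e^{2iθ}`. Since `|2θ| < π`, both principal logarithms are explicit. -/
theorem re_logPrimitive_sub {R : ℝ} {s : ℂ} (hR : 0 < R) (hs : ‖s - R‖ = R) (h0 : s ≠ 0) :
    (logPrimitive s - logPrimitive (s - R)).re =
      ‖s‖ * newtonIndicator s.arg + R * Real.log R - R := by
  have h1 := norm_sq_of_norm_sub_eq hs
  have hre := re_pos_of_norm_sub_eq hR hs h0
  have hn : 0 < ‖s‖ := norm_pos_iff.2 h0
  have hsre : s.re = ‖s‖ * Real.cos s.arg := (Complex.norm_mul_cos_arg s).symm
  have hsim : s.im = ‖s‖ * Real.sin s.arg := (Complex.norm_mul_sin_arg s).symm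
  have harg : |s.arg| < Real.pi / 2 := Complex.abs_arg_lt_pi_div_two_iff.2 (Or.inl hre)
  have hcos : 0 < Real.cos s.arg := Real.cos_pos_of_mem_Ioo (abs_lt.1 harg)
  have hr : ‖s‖ = 2 * R * Real.cos s.arg := by
    apply mul_right_cancel₀ hn.ne'
    rw [hsre] at h1
    linarith
  have hpolar : s - R = (R : ℂ) * Complex.exp ((2 * s.arg : ℝ) * Complex.I) := by
    apply Complex.ext
    · rw [Complex.re_ofReal_mul, Complex.exp_ofReal_mul_I_re, Real.cos_two_mul]
      rw [Complex.sub_re, hsre, hr, Complex.ofReal_re]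
      ring
    · rw [Complex.im_ofReal_mul, Complex.exp_ofReal_mul_I_im, Real.sin_two_mul]
      rw [Complex.sub_im, hsim, hr, Complex.ofReal_im]
      ring
  have hlog : Complex.log (s - R) = (Real.log R : ℂ) + (2 * s.arg : ℝ) * Complex.I := by
    rw [hpolar, Complex.log_ofReal_mul hR (Complex.exp_ne_zero _), Complex.log_exp]
    · simp; linarith [(abs_lt.1 harg).1]
    · simp; linarith [(abs_lt.1 harg).2]
  have hlogs : Complex.log s = (Real.log ‖s‖ : ℂ) + (s.arg : ℝ) * Complex.I := by
    apply Complex.ext <;> simp [Complex.log_re, Complex.log_im]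
  have hll : Real.log ‖s‖ = Real.log R + Real.log (2 * Real.cos s.arg) := by
    rw [← Real.log_mul hR.ne' (by positivity)]
    congr 1
    rw [hr]; ring
  rw [logPrimitive, logPrimitive, hlog, hlogs]
  simp only [Complex.sub_re, Complex.mul_re, Complex.add_re, Complex.add_im, Complex.mul_im,
    Complex.ofReal_re, Complex.ofReal_im, Complex.I_re, Complex.I_im, Complex.sub_im]
  rw [newtonIndicator, hll]
  linear_combination Real.log (2 * Real.cos s.arg) * hsre + s.arg * hsim

/-! ### Stirling-type bound on the circle. -/

theorem summable_inv_one_add_sq : Summable fun j : ℕ => 17 / (1 + (j : ℝ) ^ 2) := by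
  refine Summable.of_nonneg_of_le (fun j => by positivity) (fun j => ?_)
    ((Real.summable_one_div_nat_pow.2 one_lt_two).mul_left 17 |>.comp_injective
      (add_left_injective 1) |>.mul_left 4)
  simp only [Function.comp]
  rw [div_le_iff₀ (by positivity)]
  push_cast
  field_simp
  nlinarith [sq_nonneg ((j : ℝ) - 1)]

/-- The Stirling sequence decreases; the constant 1 makes `N = 1` an equality. -/
theorem log_factorial_le {N : ℕ} (hN : N ≠ 0) :
    Real.log N.factorial ≤ N * Real.log N - N + Real.log N / 2 + 1 := by
  obtain ⟨n, rfl⟩ := Nat.exists_eq_succ_of_ne_zero hN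
  have h1 := Stirling.log_stirlingSeq'_antitone (Nat.zero_le n)
  simp only [Function.comp] at h1
  rw [Stirling.log_stirlingSeq_formula, Stirling.log_stirlingSeq_formula] at h1
  have hp : (0 : ℝ) < (n.succ : ℝ) := by positivity
  rw [Real.log_div hp.ne' (Real.exp_ne_zero 1), Real.log_mul two_ne_zero hp.ne'] at h1
  simp at h1 ⊢
  nlinarith

/-- Stirling's bound for `N! / |s (s - 1) ⋯ (s - N)|` on the circle `|s - N| = N`. -/
theorem exists_log_factorial_add_le : ∃ K : ℝ, ∀ N : ℕ, N ≠ 0 → ∀ s : ℂ, ‖s - N‖ = N → 1 ≤ ‖s‖ →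
    Real.log N.factorial + ‖s‖ * newtonIndicator s.arg + Real.log ‖s‖ / 2 ≤
      K + ∑ j ∈ Finset.range (N + 1), Real.log ‖s - j‖ := by
  refine ⟨1 + ∑' j : ℕ, 17 / (1 + (j : ℝ) ^ 2), fun N hN s hs hs1 => ?_⟩
  have hNpos : (0 : ℝ) < N := by positivity
  have hs' : ‖s - ((N : ℝ) : ℂ)‖ = N := by simpa using hs
  have h0 : s ≠ 0 := by rintro rfl; simp at hs1; linarith
  have hstep : ∀ j ∈ Finset.range N,
      (logPrimitive (s - j) - logPrimitive (s - (j + 1 : ℕ))).re ≤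
        17 / (1 + (j : ℝ) ^ 2) + (Real.log ‖s - j‖ + Real.log ‖s - (j + 1 : ℕ)‖) / 2 := by
    intro j hj
    have hjN : (j : ℝ) + 1 ≤ N := by exact_mod_cast Finset.mem_range.1 hj
    have := norm_logPrimitive_sub_trapezoid_le (w := s - j) (M := 17 / (1 + (j : ℝ) ^ 2))
      (by positivity) (fun t ht0 ht1 => ?_) (fun t ht0 ht1 => ?_)
    · have hre := (Complex.re_le_norm _).trans this
      rw [show s - j - 1 = s - (j + 1 : ℕ) by push_cast; ring] at hre
      rw [Complex.sub_re, ← Complex.ofReal_ofNat, Complex.div_ofReal_re, Complex.add_re,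
        Complex.log_re, Complex.log_re] at hre
      linarith
    · have := sub_mem_slitPlane (t := j + t) hNpos hs' h0 (by linarith)
      convert this using 1
      push_cast; ring
    · have := norm_sq_add_sq_le (t := j + t) hNpos hs' (by positivity) (by linarith)
      rw [show s - ((j + t : ℝ) : ℂ) = s - j - t by push_cast; ring] at this
      rw [div_mul_eq_mul_div, le_div_iff₀ (by positivity)]
      have hj0 : (0 : ℝ) ≤ j := by positivity
      nlinarith
  have hsum := Finset.sum_le_sum hstep
  rw [Finset.sum_add_distrib, ← Complex.re_sum,
    Finset.sum_range_sub' (fun j : ℕ => logPrimitive (s - (j : ℕ))), ← Finset.sum_div,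
    Finset.sum_add_distrib] at hsum
  -- The trapezoid sum gives half weight to both ends. The missing `log ‖s - N‖ / 2 = log N / 2`
  -- cancels the same term in Stirling's bound, and the missing `log ‖s‖ / 2` is the one in the
  -- statement.
  have hA := Finset.sum_range_succ (fun j : ℕ => Real.log ‖s - j‖) N
  have hB := Finset.sum_range_succ' (fun j : ℕ => Real.log ‖s - j‖) N
  have hC := summable_inv_one_add_sq.sum_le_tsum (Finset.range N) (fun j _ => by positivity)
  have hD := re_logPrimitive_sub hNpos hs' h0
  have hF := log_factorial_le hN
  rw [hs] at hA
  simp only [Nat.cast_zero, sub_zero] at hB hsum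
  rw [Complex.ofReal_natCast] at hD
  rw [hD] at hsum
  linarith

/-! ### Newton interpolation with contour-integral remainder. -/

/-- The product `(z - 1) (z - 2) ⋯ (z - k)`. -/
noncomputable def nodeProd (k : ℕ) (z : ℂ) : ℂ := ∏ j ∈ Finset.range k, (z - (j + 1 : ℕ))

theorem nodeProd_succ (k : ℕ) (z : ℂ) :
    nodeProd (k + 1) z = nodeProd k z * (z - (k + 1 : ℕ)) :=
  Finset.prod_range_succ _ _

theorem continuous_nodeProd (k : ℕ) : Continuous (nodeProd k) := by
  unfold nodeProd
  fun_prop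

theorem mul_nodeProd (k : ℕ) (z : ℂ) :
    z * nodeProd k z = ∏ j ∈ Finset.range (k + 1), (z - (j : ℂ)) := by
  rw [Finset.prod_range_succ', nodeProd, mul_comm]
  simp

/-- The divided difference of `g` at the nodes `1, …, k, z`, as a Cauchy integral. -/
noncomputable def dividedDiff (g : ℂ → ℂ) (c : ℂ) (R : ℝ) (k : ℕ) (z : ℂ) : ℂ :=
  (2 * Real.pi * Complex.I : ℂ)⁻¹ * ∮ s in C(c, R), g s / (nodeProd k s * (s - z))

theorem sub_ne_zero_of_mem_sphere {c s w : ℂ} {R : ℝ} (hs : s ∈ Metric.sphere c R)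
    (hw : w ∈ Metric.ball c R) : s - w ≠ 0 := by
  rw [sub_ne_zero]
  rintro rfl
  exact (Metric.mem_ball.1 hw).ne (Metric.mem_sphere.1 hs)

theorem nodeProd_ne_zero {c s : ℂ} {R : ℝ} {k : ℕ} (hs : s ∈ Metric.sphere c R)
    (hk : ∀ j < k, ((j + 1 : ℕ) : ℂ) ∈ Metric.ball c R) : nodeProd k s ≠ 0 :=
  Finset.prod_ne_zero_iff.2 fun j hj =>
    sub_ne_zero_of_mem_sphere hs (hk j (Finset.mem_range.1 hj))

theorem circleIntegrable_div_nodeProd {g : ℂ → ℂ} {c z : ℂ} {R : ℝ} {k : ℕ} (hR : 0 ≤ R)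
    (hg : ContinuousOn g (Metric.sphere c R))
    (hk : ∀ j < k, ((j + 1 : ℕ) : ℂ) ∈ Metric.ball c R) (hz : z ∈ Metric.ball c R) :
    CircleIntegrable (fun s => g s / (nodeProd k s * (s - z))) c R := by
  refine ContinuousOn.circleIntegrable hR (hg.div ?_ fun s hs => ?_)
  · exact ((continuous_nodeProd k).mul (continuous_id.sub continuous_const)).continuousOn
  · exact mul_ne_zero (nodeProd_ne_zero hs hk) (sub_ne_zero_of_mem_sphere hs hz)

theorem dividedDiff_zero {g : ℂ → ℂ} {c z : ℂ} {R : ℝ} (hg : DiffContOnCl ℂ g (Metric.ball c R))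
    (hz : z ∈ Metric.ball c R) : dividedDiff g c R 0 z = g z := by
  rw [← hg.two_pi_i_inv_smul_circleIntegral_sub_inv_smul hz, dividedDiff]
  simp [nodeProd, div_eq_inv_mul]

/-- Partial fractions: `(z - a) / ((s - a)(s - z)) = 1 / (s - z) - 1 / (s - a)` with `a = k + 1`. -/
theorem sub_mul_dividedDiff_succ {g : ℂ → ℂ} {c z : ℂ} {R : ℝ} {k : ℕ} (hR : 0 ≤ R)
    (hg : ContinuousOn g (Metric.sphere c R))
    (hk : ∀ j < k + 1, ((j + 1 : ℕ) : ℂ) ∈ Metric.ball c R) (hz : z ∈ Metric.ball c R) :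
    (z - (k + 1 : ℕ)) * dividedDiff g c R (k + 1) z =
      dividedDiff g c R k z - dividedDiff g c R k (k + 1 : ℕ) := by
  have hk' : ∀ j < k, ((j + 1 : ℕ) : ℂ) ∈ Metric.ball c R := fun j hj => hk j (by omega)
  unfold dividedDiff
  rw [mul_left_comm, ← mul_sub, ← circleIntegral.integral_sub
    (circleIntegrable_div_nodeProd hR hg hk' hz)
    (circleIntegrable_div_nodeProd hR hg hk' (hk k (by omega))),
    ← circleIntegral.integral_const_mul]
  congr 1
  refine circleIntegral.integral_congr hR fun s hs => ?_
  have h1 := nodeProd_ne_zero hs hk'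
  have h2 := sub_ne_zero_of_mem_sphere hs hz
  have h3 := sub_ne_zero_of_mem_sphere hs (hk k (by omega))
  simp only [nodeProd_succ]
  field_simp
  ring

theorem eq_sum_dividedDiff_add {g : ℂ → ℂ} {c z : ℂ} {R : ℝ} (hR : 0 ≤ R)
    (hg : DiffContOnCl ℂ g (Metric.ball c R)) (hgs : ContinuousOn g (Metric.sphere c R))
    (hz : z ∈ Metric.ball c R) (k : ℕ)
    (hk : ∀ j < k, ((j + 1 : ℕ) : ℂ) ∈ Metric.ball c R) :
    g z = ∑ i ∈ Finset.range k, dividedDiff g c R i (i + 1 : ℕ) * nodeProd i z +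
      nodeProd k z * dividedDiff g c R k z := by
  induction k with
  | zero => simp [dividedDiff_zero hg hz, nodeProd]
  | succ k ih =>
    rw [ih fun j hj => hk j (by omega), Finset.sum_range_succ, nodeProd_succ, mul_assoc,
      sub_mul_dividedDiff_succ hR hgs hk hz]
    ring

theorem prod_range_natCast_sub (m n : ℕ) :
    ∏ j ∈ Finset.range n, ((m : ℂ) - (j : ℂ)) = (n.factorial : ℂ) * (m.choose n : ℂ) := by
  rw [← descPochhammer_eval_eq_prod_range, descPochhammer_eval_eq_descFactorial,
    Nat.descFactorial_eq_factorial_mul_choose, Nat.cast_mul]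

theorem eq_of_sum_choose_eq {a b : ℕ → ℂ} {N : ℕ}
    (h : ∀ m ≤ N, ∑ n ∈ Finset.range (m + 1), (m.choose n : ℂ) * a n =
      ∑ n ∈ Finset.range (m + 1), (m.choose n : ℂ) * b n) : ∀ m ≤ N, a m = b m := by
  intro m
  induction m using Nat.strong_induction_on with
  | _ m ih =>
    intro hm
    have := h m hm
    rw [Finset.sum_range_succ, Finset.sum_range_succ, Finset.sum_congr rfl fun n hn => by
      rw [ih n (Finset.mem_range.1 hn) ((Finset.mem_range.1 hn).le.trans hm)]] at this
    simpa using this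

theorem sum_choose_mul_alternating (f : ℕ → ℂ) (m : ℕ) :
    ∑ n ∈ Finset.range (m + 1), (m.choose n : ℂ) * ((-1) ^ n *
      ∑ k ∈ Finset.range (n + 1), (n.choose k : ℂ) * (-1) ^ k * f k) = f m := by
  have h := shift_eq_sum_fwdDiff_iter (h := 1) f m 0
  simp only [smul_eq_mul, mul_one, zero_add, nsmul_eq_mul] at h
  rw [h]
  refine Finset.sum_congr rfl fun n _ => ?_
  rw [fwdDiff_iter_eq_sum_shift, Finset.mul_sum]
  congr 1
  refine Finset.sum_congr rfl fun k hk => ?_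
  have hkn : k ≤ n := Nat.lt_succ_iff.1 (Finset.mem_range.1 hk)
  simp only [smul_eq_mul, mul_one, zero_add, zsmul_eq_mul]
  push_cast
  have : ((-1 : ℂ)) ^ n = (-1) ^ (n - k) * (-1) ^ k := by rw [← pow_add, Nat.sub_add_cancel hkn]
  rw [this]
  have h2 : ((-1 : ℂ)) ^ k * (-1) ^ k = 1 := by rw [← mul_pow]; simp
  linear_combination (-1) ^ (n - k) * (n.choose k : ℂ) * f k * h2

/-- Newton's interpolation formula at the nodes `0, …, N`, with the remainder as a contour
integral over a circle that contains `1, …, N` (but not necessarily `0`) in its interior. -/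
theorem sub_newton_sum_eq {f g : ℂ → ℂ} {c : ℂ} {R : ℝ} {N : ℕ} (hR : 0 ≤ R)
    (hg : DiffContOnCl ℂ g (Metric.ball c R)) (hgs : ContinuousOn g (Metric.sphere c R))
    (hfg : ∀ z ∈ Metric.ball c R, f z = f 0 + z * g z)
    (hN : ∀ j < N, ((j + 1 : ℕ) : ℂ) ∈ Metric.ball c R) {z : ℂ} (hz : z ∈ Metric.ball c R) :
    f z - ∑ n ∈ Finset.range (N + 1), (∏ j ∈ Finset.range n, (z - (j : ℂ))) / (n.factorial : ℂ) *
      ((-1) ^ n * ∑ k ∈ Finset.range (n + 1), (n.choose k : ℂ) * (-1) ^ k * f k) =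
      z * nodeProd N z * dividedDiff g c R N z := by
  let b : ℕ → ℂ := fun n => n.casesOn (f 0) fun n =>
    ((n + 1).factorial : ℂ) * dividedDiff g c R n (n + 1 : ℕ)
  have hexp : ∀ w ∈ Metric.ball c R, f w =
      ∑ n ∈ Finset.range (N + 1), (∏ j ∈ Finset.range n, (w - (j : ℂ))) / (n.factorial : ℂ) * b n +
      w * nodeProd N w * dividedDiff g c R N w := by
    intro w hw
    rw [hfg w hw, eq_sum_dividedDiff_add hR hg hgs hw N hN, Finset.sum_range_succ', mul_add,
      Finset.mul_sum]
    have hsum : ∑ n ∈ Finset.range N,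
        (∏ j ∈ Finset.range (n + 1), (w - (j : ℂ))) / ((n + 1).factorial : ℂ) * b (n + 1) =
        ∑ n ∈ Finset.range N, w * (dividedDiff g c R n (n + 1 : ℕ) * nodeProd n w) := by
      refine Finset.sum_congr rfl fun n _ => ?_
      have : ((n + 1).factorial : ℂ) ≠ 0 := Nat.cast_ne_zero.2 (Nat.factorial_ne_zero _)
      rw [← mul_nodeProd]
      simp only [b]
      field_simp
    rw [hsum, show b 0 = f 0 from rfl]
    simp only [Finset.range_zero, Finset.prod_empty, Nat.factorial_zero, Nat.cast_one, div_one,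
      one_mul]
    ring
  -- At `z = m` the remainder vanishes and the expansion becomes a triangular binomial system, which
  -- determines the coefficients. The case `m = 0` is separate, since `0` need not lie in the disc.
  have hb : ∀ m ≤ N, b m =
      (-1) ^ m * ∑ k ∈ Finset.range (m + 1), (m.choose k : ℂ) * (-1) ^ k * f k := by
    refine eq_of_sum_choose_eq fun m hm => ?_
    rw [sum_choose_mul_alternating (fun k => f k)]
    rcases Nat.eq_zero_or_pos m with rfl | hm0
    · simp [b]
    have hmem : (m : ℂ) ∈ Metric.ball c R := by
      have := hN (m - 1) (by omega)
      rwa [Nat.sub_add_cancel hm0] at this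
    rw [hexp m hmem, mul_nodeProd, prod_range_natCast_sub, Nat.choose_eq_zero_of_lt (by omega)]
    simp only [Nat.cast_zero, mul_zero, zero_mul, add_zero]
    rw [← Finset.sum_subset (Finset.range_mono (Nat.succ_le_succ hm))]
    · refine Finset.sum_congr rfl fun n _ => ?_
      have : (n.factorial : ℂ) ≠ 0 := Nat.cast_ne_zero.2 (Nat.factorial_ne_zero _)
      rw [prod_range_natCast_sub, mul_div_cancel_left₀ _ this]
    · intro n _ hn
      rw [prod_range_natCast_sub, Nat.choose_eq_zero_of_lt (by simpa using hn)]
      simp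
  rw [hexp z hz, sub_eq_iff_eq_add, add_comm]
  congr 1
  exact Finset.sum_congr rfl fun n hn => by
    rw [hb n (Nat.lt_succ_iff.1 (Finset.mem_range.1 hn))]

/-! ### Bounds for the integrand on the circle. -/

/-- With `c = cos θ`, the bounds `c log (2c) ≥ c - 1/2` and `θ sin θ ≥ 1 - c²` suffice.
Nonnegativity lets the constant `f 0` be absorbed into the growth bound. -/
theorem newtonIndicator_nonneg {θ : ℝ} (hθ : |θ| ≤ Real.pi / 2) : 0 ≤ newtonIndicator θ := by
  have hc : 0 ≤ Real.cos θ := Real.cos_nonneg_of_mem_Icc (abs_le.1 hθ)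
  have hs : Real.sin θ ^ 2 ≤ θ * Real.sin θ := by
    rcases le_total 0 θ with h | h
    · have h1 := Real.sin_le h
      have h2 := Real.sin_nonneg_of_nonneg_of_le_pi h (by linarith [(abs_le.1 hθ).2])
      nlinarith
    · have h1 := Real.le_sin h
      have h2 := Real.sin_nonpos_of_nonpos_of_neg_pi_le h (by linarith [(abs_le.1 hθ).1])
      nlinarith
  have h1 := Real.sin_sq_add_cos_sq θ
  have h2 := Real.cos_le_one θ
  unfold newtonIndicator
  rcases hc.eq_or_lt with h | h
  · rw [← h, zero_mul, zero_add]
    exact (sq_nonneg _).trans hs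
  · have h3 := Real.one_sub_inv_le_log_of_pos (show 0 < 2 * Real.cos θ by positivity)
    have h4 : Real.cos θ - 1 / 2 ≤ Real.cos θ * Real.log (2 * Real.cos θ) := by
      refine le_trans (le_of_eq ?_) (mul_le_mul_of_nonneg_left h3 hc)
      field_simp
    nlinarith

/-- Factor by factor: `|s - k|² = k² + 2 (N - k) Re s ≥ k²`. -/
theorem factorial_le_norm_nodeProd {N : ℕ} (hN : N ≠ 0) {s : ℂ} (hs : ‖s - N‖ = N) :
    (N.factorial : ℝ) ≤ ‖nodeProd N s‖ := by
  rw [nodeProd, norm_prod, ← Finset.prod_range_add_one_eq_factorial, Nat.cast_prod]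
  refine Finset.prod_le_prod (fun _ _ => by positivity) fun j hj => ?_
  have hjN : ((j + 1 : ℕ) : ℝ) ≤ N := by exact_mod_cast Finset.mem_range.1 hj
  have hNpos : (0 : ℝ) < N := by positivity
  have h1 := norm_sq_of_norm_sub_eq (R := N) (by simpa using hs)
  refine (sq_le_sq₀ (by positivity) (norm_nonneg _)).1 ?_
  rw [Complex.sq_norm, Complex.normSq_apply] at h1 ⊢
  have hre : 0 ≤ s.re := by
    by_contra! h
    nlinarith [mul_pos hNpos (neg_pos.2 h), mul_self_nonneg s.re, mul_self_nonneg s.im]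
  simp only [Complex.sub_re, Complex.sub_im, Complex.natCast_re, Complex.natCast_im, sub_zero]
  nlinarith [mul_nonneg hre (sub_nonneg.2 hjN)]

theorem exists_factorial_mul_exp_le : ∃ K : ℝ, 0 ≤ K ∧ ∀ N : ℕ, N ≠ 0 → ∀ s : ℂ, ‖s - N‖ = N →
    1 ≤ ‖s‖ → (N.factorial : ℝ) * Real.exp (‖s‖ * newtonIndicator s.arg) ≤
      K * ‖s‖ ^ (1 / 2 : ℝ) * ‖nodeProd N s‖ := by
  obtain ⟨K, hK⟩ := exists_log_factorial_add_le
  refine ⟨Real.exp K, (Real.exp_pos _).le, fun N hN s hs hs1 => ?_⟩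
  have hr : 0 < ‖s‖ := by linarith
  have hp : 0 < ‖nodeProd N s‖ :=
    lt_of_lt_of_le (by positivity) (factorial_le_norm_nodeProd hN hs)
  have hne : s * nodeProd N s ≠ 0 := mul_ne_zero (norm_pos_iff.1 hr) (norm_pos_iff.1 hp)
  have h := hK N hN s hs hs1
  rw [← Real.log_prod, ← norm_prod, ← mul_nodeProd, norm_mul, Real.log_mul hr.ne' hp.ne'] at h
  · rw [← Real.exp_log (show (0 : ℝ) < N.factorial by positivity), Real.rpow_def_of_pos hr,
      ← Real.exp_log hp, ← Real.exp_add, ← Real.exp_add, ← Real.exp_add, Real.exp_le_exp]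
    linarith
  · intro j hj
    rw [mul_nodeProd] at hne
    exact norm_ne_zero_iff.2 (Finset.prod_ne_zero_iff.1 hne j hj)

/-- For `|s| ≥ 1` the Stirling bound applies, and `r^{1/2}` against the `1 / r` in `g` leaves the
exponent `β - 1/2`. Near `0`, boundedness of `g` and the factorial bound suffice. -/
theorem exists_norm_mul_factorial_le {g : ℂ → ℂ} {β C C' : ℝ} (hβ : β < 1 / 2)
    (hC : ∀ z : ℂ, 0 ≤ z.re → 1 ≤ ‖z‖ →
      ‖z‖ * ‖g z‖ ≤ C * Real.exp (‖z‖ * newtonIndicator z.arg) * (1 + ‖z‖) ^ β)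
    (hC' : ∀ z : ℂ, 0 ≤ z.re → ‖z‖ ≤ 1 → ‖g z‖ ≤ C') :
    ∃ K : ℝ, ∀ N : ℕ, N ≠ 0 → ∀ s : ℂ, ‖s - N‖ = N →
      ‖g s‖ * N.factorial ≤ K * (1 + ‖s‖) ^ (β - 1 / 2) * ‖nodeProd N s‖ := by
  obtain ⟨K, hK0, hK⟩ := exists_factorial_mul_exp_le
  have hC0 : 0 ≤ C := by
    have h := (norm_nonneg _).trans ((le_mul_of_one_le_left (norm_nonneg _) (by simp)).trans
      (hC 1 (by simp) (by simp)))
    by_contra! hneg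
    have : C * (Real.exp (‖(1 : ℂ)‖ * newtonIndicator (Complex.arg 1)) *
      (1 + ‖(1 : ℂ)‖) ^ β) < 0 := mul_neg_of_neg_of_pos hneg (by positivity)
    linarith
  have hC0' : 0 ≤ C' := (norm_nonneg _).trans (hC' 0 (by simp) (by simp))
  refine ⟨C * K * 2 ^ (1 / 2 : ℝ) + C' * 2 ^ (1 / 2 - β), fun N hN s hs => ?_⟩
  have hNpos : (0 : ℝ) < N := by positivity
  have hre : 0 ≤ s.re := by
    rcases eq_or_ne s 0 with rfl | h0
    · simp
    · exact (re_pos_of_norm_sub_eq hNpos (by simpa using hs) h0).le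
  have h1r : 0 < 1 + ‖s‖ := by positivity
  rw [add_mul, add_mul]
  rcases le_total 1 ‖s‖ with h1 | h1
  · have hr : 0 < ‖s‖ := by linarith
    refine le_add_of_le_of_nonneg ?_ (by positivity)
    refine le_of_mul_le_mul_left ?_ hr
    have hhalf : ‖s‖ ^ (1 / 2 : ℝ) ≤ ‖s‖ * (2 ^ (1 / 2 : ℝ) * (1 + ‖s‖) ^ (-(1 / 2) : ℝ)) := by
      rw [Real.rpow_neg h1r.le, ← div_eq_mul_inv, mul_div_assoc', le_div_iff₀ (by positivity),
        ← Real.mul_rpow hr.le h1r.le]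
      calc (‖s‖ * (1 + ‖s‖)) ^ (1 / 2 : ℝ) ≤ (‖s‖ ^ 2 * 2) ^ (1 / 2 : ℝ) := by
            apply Real.rpow_le_rpow (by positivity) _ (by norm_num)
            nlinarith
        _ = ‖s‖ * 2 ^ (1 / 2 : ℝ) := by
            rw [Real.mul_rpow (by positivity) (by norm_num), ← Real.sqrt_eq_rpow,
              Real.sqrt_sq hr.le]
    calc ‖s‖ * (‖g s‖ * N.factorial) = ‖s‖ * ‖g s‖ * N.factorial := by ring
      _ ≤ C * Real.exp (‖s‖ * newtonIndicator s.arg) * (1 + ‖s‖) ^ β * N.factorial := by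
          gcongr ?_ * _
          exact hC s hre h1
      _ = C * (1 + ‖s‖) ^ β * (N.factorial * Real.exp (‖s‖ * newtonIndicator s.arg)) := by ring
      _ ≤ C * (1 + ‖s‖) ^ β * (K * ‖s‖ ^ (1 / 2 : ℝ) * ‖nodeProd N s‖) := by
          gcongr _ * ?_
          exact hK N hN s hs h1
      _ ≤ C * (1 + ‖s‖) ^ β * (K * (‖s‖ * (2 ^ (1 / 2 : ℝ) * (1 + ‖s‖) ^ (-(1 / 2) : ℝ))) *
            ‖nodeProd N s‖) := by gcongr
      _ = _ := by
          rw [sub_eq_add_neg, Real.rpow_add h1r]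
          ring
  · refine le_add_of_nonneg_of_le (by positivity) ?_
    have h2 : 1 ≤ 2 ^ (1 / 2 - β) * (1 + ‖s‖) ^ (β - 1 / 2) := by
      rw [← neg_sub (1 / 2) β, Real.rpow_neg h1r.le, ← div_eq_mul_inv, one_le_div (by positivity)]
      exact Real.rpow_le_rpow h1r.le (by linarith) (by linarith)
    calc ‖g s‖ * N.factorial ≤ C' * 1 * ‖nodeProd N s‖ := by
          rw [mul_one]
          exact mul_le_mul (hC' s hre h1) (factorial_le_norm_nodeProd hN hs) (by positivity) hC0'
      _ ≤ C' * (2 ^ (1 / 2 - β) * (1 + ‖s‖) ^ (β - 1 / 2)) * ‖nodeProd N s‖ := by gcongr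
      _ = _ := by ring

/-! ### Uniform estimate of the remainder. -/

/-- Each factor satisfies `k - x ≤ k e^{-x/k}`. -/
theorem norm_nodeProd_ofReal_le (N : ℕ) {x : ℝ} (hx1 : x ≤ 1) :
    ‖nodeProd N x‖ ≤
      N.factorial * Real.exp (-x * ∑ j ∈ Finset.range N, 1 / ((j : ℝ) + 1)) := by
  rw [nodeProd, norm_prod, ← Finset.prod_range_add_one_eq_factorial, Nat.cast_prod,
    Finset.mul_sum, Real.exp_sum, ← Finset.prod_mul_distrib]
  refine Finset.prod_le_prod (fun _ _ => norm_nonneg _) fun j _ => ?_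
  have hj : (0 : ℝ) < (j : ℝ) + 1 := by positivity
  have h1 := Real.add_one_le_exp (-x * (1 / ((j : ℝ) + 1)))
  have h2 : ‖(x : ℂ) - (j + 1 : ℕ)‖ = ((j : ℝ) + 1) - x := by
    rw [← Complex.ofReal_natCast, ← Complex.ofReal_sub, Complex.norm_real, Real.norm_eq_abs,
      abs_sub_comm, abs_of_nonneg] <;> push_cast
    · rfl
    · linarith [show (0 : ℝ) ≤ j by positivity]
  rw [h2]
  push_cast
  refine le_trans (le_of_eq ?_) (mul_le_mul_of_nonneg_left h1 hj.le)
  field_simp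
  ring

/-- The factor `x` of the remainder tames the Cauchy kernel as `x → 0`, where the pole approaches
the contour, and a decay `1 / (1 + |s|)` is gained. -/
theorem mul_one_add_norm_le {R x : ℝ} {s : ℂ} (hR : 1 ≤ R) (hs : ‖s - R‖ = R) (hx0 : 0 ≤ x)
    (hx1 : x ≤ 1) : x * (1 + ‖s‖) ≤ 10 * ‖s - x‖ := by
  have h := norm_sq_add_sq_le (t := x) (by linarith) hs hx0 (by linarith)
  have h1 : x ≤ 5 * ‖s - x‖ := by
    refine (sq_le_sq₀ hx0 (by positivity)).1 ?_
    nlinarith [sq_nonneg ‖s‖, sq_nonneg ‖s - x‖]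
  have h2 : ‖s‖ ≤ 5 * ‖s - x‖ := by
    refine (sq_le_sq₀ (norm_nonneg _) (by positivity)).1 ?_
    nlinarith [sq_nonneg x, sq_nonneg ‖s - x‖]
  nlinarith [norm_nonneg s, mul_le_mul_of_nonneg_right hx1 (norm_nonneg s)]

/-- `|s| = 2R |sin ((φ - π) / 2)|` followed by Jordan's inequality; the angle `φ = π` is the origin.
-/
theorem mul_abs_sub_pi_le_norm_circleMap {R φ : ℝ} (hR : 0 ≤ R) (h0 : 0 ≤ φ)
    (h1 : φ ≤ 2 * Real.pi) : 2 * R / Real.pi * |φ - Real.pi| ≤ ‖circleMap R R φ‖ := by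
  have hpi := Real.pi_pos
  have hs : ‖circleMap (R : ℂ) R φ - R‖ = R := by simp [abs_of_nonneg hR]
  have h2 := norm_sq_of_norm_sub_eq hs
  have hre : (circleMap (R : ℂ) R φ).re = R * (1 + Real.cos φ) := by
    rw [circleMap, Complex.add_re, Complex.re_ofReal_mul, Complex.exp_ofReal_mul_I_re,
      Complex.ofReal_re]
    ring
  have hcos : 1 + Real.cos φ = 2 * Real.sin ((φ - Real.pi) / 2) ^ 2 := by
    rw [Real.sin_sq_eq_half_sub, mul_div_cancel₀ _ two_ne_zero, Real.cos_sub_pi]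
    ring
  have h3 : |(φ - Real.pi) / 2| ≤ Real.pi / 2 := abs_le.2 ⟨by linarith, by linarith⟩
  have h4 := Real.mul_abs_le_abs_sin h3
  have h5 : ‖circleMap (R : ℂ) R φ‖ = 2 * R * |Real.sin ((φ - Real.pi) / 2)| := by
    rw [← abs_of_nonneg (norm_nonneg (circleMap (R : ℂ) R φ)),
      ← abs_of_nonneg (show 0 ≤ 2 * R by positivity), ← abs_mul, ← sq_eq_sq_iff_abs_eq_abs, h2, hre,
      hcos]
    ring
  rw [h5]
  refine le_trans (le_of_eq ?_) (mul_le_mul_of_nonneg_left h4 (by positivity))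
  rw [abs_div, abs_two]
  field_simp

/-- Substituting `v = (2R/π)(φ - π)` cancels the factor `R` from arc length, so the bound is
independent of the radius. -/
theorem integral_one_add_abs_rpow_le {p R : ℝ} (hp : 1 < p) (hR : 0 < R) :
    ∫ φ in (0 : ℝ)..2 * Real.pi, R * (1 + 2 * R / Real.pi * |φ - Real.pi|) ^ (-p) ≤
      Real.pi / 2 * ∫ v : ℝ, (1 + ‖v‖) ^ (-p) := by
  have hpi := Real.pi_pos
  have hc : 0 < 2 * R / Real.pi := by positivity
  have h := intervalIntegral.integral_comp_mul_sub (a := 0) (b := 2 * Real.pi)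
    (fun v : ℝ => (1 + ‖v‖) ^ (-p)) hc.ne' (2 * R)
  have hcongr : ∀ φ : ℝ, 1 + ‖2 * R / Real.pi * φ - 2 * R‖ =
      1 + 2 * R / Real.pi * |φ - Real.pi| := fun φ => by
    rw [Real.norm_eq_abs, ← abs_of_pos hc, ← abs_mul, abs_of_pos hc]
    congr 2
    field_simp
  simp only [hcongr] at h
  rw [intervalIntegral.integral_const_mul, h, smul_eq_mul, ← mul_assoc,
    show R * (2 * R / Real.pi)⁻¹ = Real.pi / 2 by field_simp]
  refine mul_le_mul_of_nonneg_left ?_ (by positivity)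
  rw [intervalIntegral.integral_of_le]
  · refine MeasureTheory.setIntegral_le_integral (integrable_one_add_norm (by simpa using hp))
      (Eventually.of_forall fun v => by positivity)
  · have : 0 ≤ 2 * R / Real.pi * (2 * Real.pi) := by positivity
    linarith

theorem exists_norm_remainder_le {g : ℂ → ℂ} {β C C' : ℝ} (hβ : β < 1 / 2)
    (hC : ∀ z : ℂ, 0 ≤ z.re → 1 ≤ ‖z‖ →
      ‖z‖ * ‖g z‖ ≤ C * Real.exp (‖z‖ * newtonIndicator z.arg) * (1 + ‖z‖) ^ β)
    (hC' : ∀ z : ℂ, 0 ≤ z.re → ‖z‖ ≤ 1 → ‖g z‖ ≤ C') :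
    ∃ K : ℝ, ∀ N : ℕ, N ≠ 0 → ∀ x : ℝ, 0 < x → x ≤ 1 →
      ‖(x : ℂ) * nodeProd N x * dividedDiff g N N N x‖ ≤
        K * Real.exp (-x * ∑ j ∈ Finset.range N, 1 / ((j : ℝ) + 1)) := by
  obtain ⟨K, hK⟩ := exists_norm_mul_factorial_le hβ hC hC'
  have hK0 : 0 ≤ K := by
    have h := hK 1 one_ne_zero 0 (by simp)
    simpa [nodeProd] using (mul_nonneg (norm_nonneg (g 0)) (Nat.cast_nonneg _)).trans h
  have hpi := Real.pi_pos
  refine ⟨(2 * Real.pi)⁻¹ * (10 * K * (Real.pi / 2 * ∫ v : ℝ, (1 + ‖v‖) ^ (-(3 / 2 - β)))),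
    fun N hN x hx0 hx1 => ?_⟩
  set H := ∑ j ∈ Finset.range N, 1 / ((j : ℝ) + 1)
  have hNpos : (0 : ℝ) < N := by positivity
  have hN1 : (1 : ℝ) ≤ N := by exact_mod_cast Nat.one_le_iff_ne_zero.2 hN
  have hp : 1 < 3 / 2 - β := by linarith
  have hker : ∀ s : ℂ, ‖s - N‖ = N →
      ‖(x : ℂ) * nodeProd N x * (g s / (nodeProd N s * (s - x)))‖ ≤
        10 * K * Real.exp (-x * H) * (1 + ‖s‖) ^ (-(3 / 2 - β)) := by
    intro s hs
    have h1r : 0 < 1 + ‖s‖ := by positivity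
    have h1 := mul_one_add_norm_le hN1 (by simpa using hs) hx0.le hx1
    have hd : 0 < ‖s - x‖ := by
      have : 0 < x * (1 + ‖s‖) := by positivity
      linarith
    have h2 := norm_nodeProd_ofReal_le N hx1
    have h3 := hK N hN s hs
    have hq : 0 < ‖nodeProd N s‖ :=
      lt_of_lt_of_le (by positivity) (factorial_le_norm_nodeProd hN hs)
    have h4 : (1 + ‖s‖) ^ (β - 1 / 2) = (1 + ‖s‖) ^ (-(3 / 2 - β)) * (1 + ‖s‖) := by
      rw [← Real.rpow_add_one h1r.ne']
      congr 1
      ring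
    rw [norm_mul, norm_mul, norm_div, norm_mul, Complex.norm_real, Real.norm_eq_abs,
      abs_of_pos hx0, ← mul_div_assoc, div_le_iff₀ (by positivity)]
    calc x * ‖nodeProd N x‖ * ‖g s‖ ≤ x * (N.factorial * Real.exp (-x * H)) * ‖g s‖ := by
          gcongr
      _ = x * Real.exp (-x * H) * (‖g s‖ * N.factorial) := by ring
      _ ≤ x * Real.exp (-x * H) * (K * (1 + ‖s‖) ^ (β - 1 / 2) * ‖nodeProd N s‖) := by
          gcongr _ * ?_
      _ = K * Real.exp (-x * H) * (1 + ‖s‖) ^ (-(3 / 2 - β)) * ‖nodeProd N s‖ *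
            (x * (1 + ‖s‖)) := by rw [h4]; ring
      _ ≤ K * Real.exp (-x * H) * (1 + ‖s‖) ^ (-(3 / 2 - β)) * ‖nodeProd N s‖ *
            (10 * ‖s - x‖) := by gcongr _ * ?_
      _ = _ := by ring
  have hint : ‖∫ φ in (0 : ℝ)..2 * Real.pi, deriv (circleMap N N) φ •
      ((x : ℂ) * nodeProd N x * (g (circleMap N N φ) /
        (nodeProd N (circleMap N N φ) * (circleMap N N φ - x))))‖ ≤
      ∫ φ in (0 : ℝ)..2 * Real.pi, 10 * K * Real.exp (-x * H) *
        (N * (1 + 2 * N / Real.pi * |φ - Real.pi|) ^ (-(3 / 2 - β))) := by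
    refine intervalIntegral.norm_integral_le_of_norm_le (by positivity)
      (Eventually.of_forall fun φ hφ => ?_) ?_
    · have hs : ‖circleMap (N : ℂ) N φ - N‖ = N := by simp
      have h1 := mul_abs_sub_pi_le_norm_circleMap hNpos.le hφ.1.le hφ.2
      rw [Complex.ofReal_natCast] at h1
      have h2 : 0 ≤ 2 * N / Real.pi * |φ - Real.pi| := by positivity
      have h3 : (1 + ‖circleMap (N : ℂ) N φ‖) ^ (-(3 / 2 - β)) ≤
          (1 + 2 * N / Real.pi * |φ - Real.pi|) ^ (-(3 / 2 - β)) :=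
        Real.rpow_le_rpow_of_nonpos (by linarith) (by linarith) (by linarith)
      rw [norm_smul, deriv_circleMap, norm_mul, norm_circleMap_zero, Complex.norm_I, mul_one,
        abs_of_pos hNpos, mul_left_comm]
      refine mul_le_mul_of_nonneg_left ((hker _ hs).trans ?_) hNpos.le
      gcongr
    · refine Continuous.intervalIntegrable ?_ _ _
      refine continuous_const.mul (continuous_const.mul (Continuous.rpow_const (by fun_prop)
        fun φ => Or.inl ?_))
      positivity
  rw [intervalIntegral.integral_const_mul] at hint
  have hfin := integral_one_add_abs_rpow_le hp hNpos
  have heq : (x : ℂ) * nodeProd N x * dividedDiff g N N N x =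
      (2 * Real.pi * Complex.I : ℂ)⁻¹ * ∫ φ in (0 : ℝ)..2 * Real.pi, deriv (circleMap N N) φ •
      ((x : ℂ) * nodeProd N x * (g (circleMap N N φ) /
        (nodeProd N (circleMap N N φ) * (circleMap N N φ - x)))) := by
    rw [dividedDiff, mul_left_comm, ← circleIntegral.integral_const_mul, circleIntegral]
  rw [heq, norm_mul, norm_inv, norm_mul, norm_mul, Complex.norm_I, Complex.norm_real,
    Complex.norm_ofNat, Real.norm_eq_abs, abs_of_pos hpi, mul_one]
  calc _ ≤ (2 * Real.pi)⁻¹ * (10 * K * Real.exp (-x * H) *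
        (Real.pi / 2 * ∫ v : ℝ, (1 + ‖v‖) ^ (-(3 / 2 - β)))) := by
        refine mul_le_mul_of_nonneg_left (hint.trans ?_) (by positivity)
        exact mul_le_mul_of_nonneg_left hfin (by positivity)
    _ = _ := by ring

/-! ### Passage to `f` and termwise integration. -/

theorem HasModerateGrowth.exists_norm_mul_dslope_le {f : ℂ → ℂ} (hf : HasModerateGrowth f) :
    ∃ β : ℝ, β < 1 / 2 ∧ ∃ C : ℝ, ∀ z : ℂ, 0 ≤ z.re → 1 ≤ ‖z‖ →
      ‖z‖ * ‖dslope f 0 z‖ ≤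
        C * Real.exp (‖z‖ * newtonIndicator z.arg) * (1 + ‖z‖) ^ β := by
  obtain ⟨β, hβ, C, hC⟩ := hf
  -- A nonnegative exponent keeps `(1 + ‖z‖) ^ β` at least 1, so the constant `f 0` fits under the
  -- bound.
  refine ⟨max β 0, max_lt hβ (by norm_num), |C| + ‖f 0‖, fun z hz hz1 => ?_⟩
  have hψ : 0 ≤ newtonIndicator z.arg :=
    newtonIndicator_nonneg (Complex.abs_arg_le_pi_div_two_iff.2 hz)
  have hmul : z * dslope f 0 z = f z - f 0 := by
    simpa using sub_smul_dslope f 0 z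
  have h1r : 1 ≤ 1 + ‖z‖ := by linarith
  have hexp : 1 ≤ Real.exp (‖z‖ * newtonIndicator z.arg) := Real.one_le_exp (by positivity)
  have hpow : 1 ≤ (1 + ‖z‖) ^ max β 0 := Real.one_le_rpow h1r (le_max_right _ _)
  rw [← norm_mul, hmul]
  calc ‖f z - f 0‖ ≤ ‖f z‖ + ‖f 0‖ * (1 * 1) := by simpa using norm_sub_le _ _
    _ ≤ |C| * Real.exp (‖z‖ * newtonIndicator z.arg) * (1 + ‖z‖) ^ max β 0 +
        ‖f 0‖ * (Real.exp (‖z‖ * newtonIndicator z.arg) * (1 + ‖z‖) ^ max β 0) := by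
        gcongr
        refine (hC z hz).trans ?_
        gcongr
        · exact le_abs_self C
        · exact le_max_left _ _
    _ = _ := by ring

theorem cauchyNumber_mul_eq_integral (n : ℕ) (a : ℂ) :
    ((-1 : ℂ) ^ n * (cauchyNumber n : ℂ) / (n.factorial : ℂ)) * a =
      ∫ x in (0 : ℝ)..1, (∏ j ∈ Finset.range n, ((x : ℂ) - (j : ℂ))) / (n.factorial : ℂ) *
        ((-1) ^ n * a) := by
  rw [intervalIntegral.integral_mul_const, intervalIntegral.integral_div, cauchyNumber,
    ← intervalIntegral.integral_ofReal]
  push_cast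
  ring

theorem proposition1 (lam : ℝ) (hlam : lam < 0) (f : ℂ → ℂ)
    (hf : AnalyticOnNhd ℂ f {z : ℂ | lam < z.re}) (hgrowth : HasModerateGrowth f) :
    Tendsto
      (fun N : ℕ => ∑ n ∈ Finset.range N,
        ((-1 : ℂ) ^ n * (cauchyNumber n : ℂ) / (n.factorial : ℂ)) *
          ∑ k ∈ Finset.range (n + 1), (n.choose k : ℂ) * (-1 : ℂ) ^ k * f (k : ℂ))
      atTop (𝓝 (∫ x in (0 : ℝ)..1, f (x : ℂ))) := by
  have hopen : IsOpen {z : ℂ | lam < z.re} := isOpen_lt continuous_const Complex.continuous_re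
  have hg : DifferentiableOn ℂ (dslope f 0) {z : ℂ | lam < z.re} :=
    (Complex.differentiableOn_dslope (hopen.mem_nhds (by simpa using hlam))).2
      hf.differentiableOn
  obtain ⟨β, hβ, C, hC⟩ := hgrowth.exists_norm_mul_dslope_le
  have hcompact : IsCompact (Metric.closedBall (0 : ℂ) 1 ∩ {z : ℂ | 0 ≤ z.re}) :=
    (isCompact_closedBall 0 1).inter_right (isClosed_le continuous_const Complex.continuous_re)
  obtain ⟨C', hC'⟩ := hcompact.exists_bound_of_continuousOn
    (hg.continuousOn.mono fun z hz => hlam.trans_le hz.2)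
  obtain ⟨K, hK⟩ := exists_norm_remainder_le hβ hC
    (fun z hz hz1 => hC' z ⟨by simpa using hz1, hz⟩)
  have hball : ∀ N : ℕ, Metric.closedBall (N : ℂ) N ⊆ {z : ℂ | lam < z.re} := by
    intro N z hz
    have h1 := (Complex.abs_re_le_norm _).trans (mem_closedBall_iff_norm.1 hz)
    have h2 := (abs_le.1 h1).1
    simp only [Complex.sub_re, Complex.natCast_re] at h2
    exact hlam.trans_le (by linarith)
  have hmem : ∀ N : ℕ, N ≠ 0 → ∀ x : ℝ, 0 < x → x ≤ N → (x : ℂ) ∈ Metric.ball (N : ℂ) N := by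
    intro N hN x hx0 hxN
    rw [mem_ball_iff_norm, ← Complex.ofReal_natCast, ← Complex.ofReal_sub, Complex.norm_real,
      Real.norm_eq_abs, abs_sub_comm, abs_of_nonneg (by linarith)]
    linarith
  let S : ℕ → ℝ → ℂ := fun N x => ∑ n ∈ Finset.range N,
    (∏ j ∈ Finset.range n, ((x : ℂ) - (j : ℂ))) / (n.factorial : ℂ) *
      ((-1) ^ n * ∑ k ∈ Finset.range (n + 1), (n.choose k : ℂ) * (-1) ^ k * f k)
  have hScont : ∀ N, Continuous (S N) := fun N => by
    simp only [S]
    fun_prop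
  have hrem : ∀ N : ℕ, N ≠ 0 → ∀ x : ℝ, 0 < x → x ≤ 1 → ‖f x - S (N + 1) x‖ ≤
      K * Real.exp (-x * ∑ j ∈ Finset.range N, 1 / ((j : ℝ) + 1)) := by
    intro N hN x hx0 hx1
    have hN1 : (1 : ℝ) ≤ N := by exact_mod_cast Nat.one_le_iff_ne_zero.2 hN
    have hdiff := hg.mono (hball N)
    have h := sub_newton_sum_eq (f := f) (g := dslope f 0) (c := N) (R := N) (N := N)
      (Nat.cast_nonneg N) (hdiff.diffContOnCl_ball subset_rfl)
      (hdiff.continuousOn.mono Metric.sphere_subset_closedBall)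
      (fun z _ => by
        have := sub_smul_dslope f 0 z
        rw [sub_zero, smul_eq_mul] at this
        rw [this]; ring)
      (fun j hj => by
        have := hmem N hN (j + 1 : ℕ) (by positivity) (by exact_mod_cast hj)
        rwa [Complex.ofReal_natCast] at this)
      (hmem N hN x hx0 (hx1.trans hN1))
    rw [h]
    exact hK N hN x hx0 hx1
  have hsum : ∀ N : ℕ, ∑ n ∈ Finset.range N,
      ((-1 : ℂ) ^ n * (cauchyNumber n : ℂ) / (n.factorial : ℂ)) *
        ∑ k ∈ Finset.range (n + 1), (n.choose k : ℂ) * (-1 : ℂ) ^ k * f (k : ℂ) =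
      ∫ x in (0 : ℝ)..1, S N x := by
    intro N
    simp only [S, cauchyNumber_mul_eq_integral]
    rw [intervalIntegral.integral_finsetSum]
    exact fun n _ => Continuous.intervalIntegrable (by fun_prop) _ _
  simp only [hsum]
  rw [← tendsto_add_atTop_iff_nat 1]
  have hfcont : ContinuousOn (fun x : ℝ => f x) (Set.uIcc 0 1) := by
    refine hf.continuousOn.comp Complex.continuous_ofReal.continuousOn fun x hx => ?_
    rw [Set.uIcc_of_le zero_le_one] at hx
    exact hlam.trans_le (by simpa using hx.1)
  have hK0 : 0 ≤ K := nonneg_of_mul_nonneg_left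
    ((norm_nonneg _).trans (hrem 1 one_ne_zero 1 one_pos le_rfl)) (Real.exp_pos _)
  -- At `x = 0` the remainder bound would not decay, but the interval integral only sees `(0, 1]`.
  refine intervalIntegral.tendsto_integral_filter_of_dominated_convergence
    (fun x => ‖f x‖ + K) (Eventually.of_forall fun N => (hScont _).aestronglyMeasurable)
    ?_ ?_ ?_
  · filter_upwards [eventually_ne_atTop 0] with N hN
    refine Eventually.of_forall fun x hx => ?_
    rw [Set.uIoc_of_le zero_le_one] at hx
    have h1 := hrem N hN x hx.1 hx.2
    have h2 : Real.exp (-x * ∑ j ∈ Finset.range N, 1 / ((j : ℝ) + 1)) ≤ 1 := by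
      rw [Real.exp_le_one_iff, neg_mul, neg_nonpos]
      exact mul_nonneg hx.1.le (Finset.sum_nonneg fun j _ => by positivity)
    calc ‖S (N + 1) x‖ ≤ ‖f x‖ + ‖f x - S (N + 1) x‖ := norm_le_norm_add_norm_sub _ _
      _ ≤ ‖f x‖ + K := by
        gcongr
        exact h1.trans (mul_le_of_le_one_right hK0 h2)
  · exact (hfcont.norm.add continuousOn_const).intervalIntegrable
  · refine Eventually.of_forall fun x hx => ?_
    rw [Set.uIoc_of_le zero_le_one] at hx
    rw [tendsto_iff_norm_sub_tendsto_zero]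
    have hlim : Tendsto (fun N : ℕ => K * Real.exp (-x * ∑ j ∈ Finset.range N, 1 / ((j : ℝ) + 1)))
        atTop (𝓝 0) := by
      rw [← mul_zero K]
      refine (Real.tendsto_exp_atBot.comp ?_).const_mul K
      exact Real.tendsto_sum_range_one_div_nat_succ_atTop.const_mul_atTop_of_neg (by linarith [hx.1])
    refine squeeze_zero' (Eventually.of_forall fun _ => norm_nonneg _) ?_ hlim
    filter_upwards [eventually_ne_atTop 0] with N hN
    rw [norm_sub_rev]
    exact hrem N hN x hx.1 hx.2
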